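/- **Setting.** Let $\mathcal H_p,\mathcal H_d,\mathcal H_v$ be real Hilbert spaces, $A:\mathcal H_p\to\mathcal H_d$ and $T:\mathcal H_p\to\mathcal H_v$ bounded linear operators, $b\in\mathcal H_d$. For a Hilbert space $\mathcal H$ let $\Gamma_0(\mathcal H)$ be the set of proper convex lower semicontinuous functions $\mathcal H\to\mathbb R\cup\{+\infty\}$. For $\varphi:\mathcal H\to\mathbb R\cup\{+\infty\}$ put $\operatorname{dom}\varphi=\{\varphi<+\infty\}$, let $\partial\varphi$ be the subdifferential, $\operatorname{dom}(\partial\varphi)$ the set of $x$ with $\partial\varphi(x)\ne\emptyset$, $[\partial\varphi(x)]^0$ the element of minimal norm of $\partial\varphi(x)$, and $\operatorname{prox}_{\varphi}(x)=\operatorname{argmin}_{v}\{\varphi(v)+\tfrac12\|x-v\|^2\}$. Let $f:\mathcal H_p\to\mathbb R\cup\{+\infty\}$, $g\in\Gamma_0(\mathcal H_v)$, $h:\mathcal H_p\to\mathbb R\cup\{+\infty\}$, $\mathcal C=\operatorname{dom}h$. The problem is $$\min_{x\in\mathcal H_p}\{f(x)+g(Tx)+h(x):\ Ax=b\},$$ with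 Lagrangian $\mathcal L(x,\mu)=f(x)+g(Tx)+h(x)+\langle\mu,Ax-b\rangle$. **Assumptions on the functions.** * (A.1) $f$, $g\circ T$ and $h$ belong to $\Gamma_0(\mathcal H_p)$. * (A.2) $(f,\mathcal C)$ is $(F,\zeta)$-smooth for some $F:\mathcal H_p\to\mathbb R\cup\{+\infty\}$ and $\zeta:\,]0,1]\to[0,+\infty[$. That is, $\mathcal C\subset\operatorname{dom}f$ and there is an open set $\mathcal C_0$ with $\mathcal C\subset\mathcal C_0\subset\operatorname{int}(\operatorname{dom}F)$ such that $F$ and $f$ are differentiable on $\mathcal C_0$ (Gateaux differentiability suffices), $F-f$ is convex on $\mathcal C_0$ (if $\mathcal C_0$ is not convex: on every segment contained in $\mathcal C_0$), and $$\sup_{x,s\in\mathcal C,\ \gamma\in]0,1]}\frac{D_F(x+\gamma(s-x),x)}{\zeta(\gamma)}<+\infty,\qquad D_F(z,x)=F(z)-F(x)-\langle\nabla F(x),z-x\rangle,$$ where $0/0=0$ and $t/0=+\infty$ for $t>0$. * (A.3) $\mathcal C$ is weakly compact. * (A.4) $T\mathcal C\subset\operatorname{dom}(\partial g)$ and $\sup_{x\in\mathcal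 C}\|[\partial g(Tx)]^0\|<\infty$. * (A.6) $\mathcal L$ has a saddle point: there is $(x^\star,\mu^\star)\in\mathcal H_p\times\mathcal H_d$ with $\mathcal L(x^\star,\mu)\le\mathcal L(x^\star,\mu^\star)\le\mathcal L(x,\mu^\star)$ for all $(x,\mu)\in\mathcal H_p\times\mathcal H_d$. **Assumptions on the parameters.** $(\gamma_k),(\beta_k),(\theta_k),(\rho_k)$, $k\in\mathbb N=\{0,1,2,\dots\}$, are real sequences with $\beta_k>0$ and: * (P.1) $\gamma_k\in\,]0,1]$ for all $k$, and $(\zeta(\gamma_k))$, $(\gamma_k^2/\beta_k)$, $(\gamma_k\beta_k)$ are summable. * (P.2) $(\gamma_k)$ is not summable. * (P.3) $(\beta_k)$ is non-increasing and converges to $0$. * (P.4) $(\rho_k)$ is non-decreasing and $0<\underline\rho=\inf_k\rho_k\le\sup_k\rho_k=\overline\rho<+\infty$. * (P.5) There are constants $\underline M,\overline M>0$ with $\underline M\le\gamma_k/\gamma_{k+1}\le\overline M$ for all $k$. * (P.6) There is $c>0$ with $\theta_k=\gamma_k/c$ for all $k$ and $\overline M/c-\underline\rho/2<0$. **Algorithm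 (CGALP).** Start from $x_0\in\mathcal C$ and $\mu_0\in\operatorname{ran}A$, and for $k=0,1,2,\dots$ let $$\begin{aligned} y_k&=\operatorname{prox}_{\beta_kg}(Tx_k),\\ z_k&=\nabla f(x_k)+T^*(Tx_k-y_k)/\beta_k+A^*\mu_k+\rho_kA^*(Ax_k-b),\\ s_k&\in\operatorname{Argmin}_{s\in\mathcal H_p}\{h(s)+\langle z_k,s\rangle\},\\ x_{k+1}&=x_k-\gamma_k(x_k-s_k),\\ \mu_{k+1}&=\mu_k+\theta_k(Ax_{k+1}-b). \end{aligned}$$ **Theorem 4.1 (Asymptotic feasibility).** Assume (A.1)–(A.4), (A.6) and (P.1)–(P.6), and let $(x_k)$ be any sequence of iterates generated by the algorithm. Put $\Gamma_k=\sum_{i=0}^k\gamma_i$ and $\bar x_k=\sum_{i=0}^k\gamma_ix_i/\Gamma_k$. Then: 1. $Ax_k\to b$ strongly as $k\to\infty$. 2. $\inf_{0\le i\le k}\|Ax_i-b\|=O(1/\sqrt{\Gamma_k})$, and there is a subsequence $(x_{k_j})$ such that $\|Ax_{k_j}-b\|\le1/\sqrt{\Gamma_{k_j}}$ for all $j\in\mathbb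 N$. 3. $\|A\bar x_k-b\|=O(1/\sqrt{\Gamma_k})$. -/

import Mathlib

open Filter Topology Asymptotics

namespace CGALP

/-! Functions with values in `ℝ ∪ {+∞}` are functions into `EReal` that never take the value `⊥`. -/

section ConvexAnalysis

variable {H : Type*} [NormedAddCommGroup H] [InnerProductSpace ℝ H]

/-- The (effective) domain of an extended-real-valued function. -/
def dom (φ : H → EReal) : Set H := {x | φ x < ⊤}

/-- `φ ∈ Γ₀(H)`: `φ` is proper, convex and lower semicontinuous, with values in `ℝ ∪ {+∞}`. -/
structure Gamma0 (φ : H → EReal) : Prop where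
  ne_bot : ∀ x, φ x ≠ ⊥
  proper : (dom φ).Nonempty
  convex : ∀ x y : H, ∀ a b : ℝ, 0 ≤ a → 0 ≤ b → a + b = 1 →
    φ (a • x + b • y) ≤ (a : EReal) * φ x + (b : EReal) * φ y
  lsc : LowerSemicontinuous φ

/-- The subdifferential `∂φ(x)`. -/
def subdiff (φ : H → EReal) (x : H) : Set H :=
  {u | ∀ y, φ x + ((inner ℝ u (y - x) : ℝ) : EReal) ≤ φ y}

/-- The domain of the subdifferential. -/
def domSubdiff (φ : H → EReal) : Set H := {x | (subdiff φ x).Nonempty}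

/-- `u = [∂φ(x)]⁰`, the element of minimal norm of `∂φ(x)`. -/
def IsMinNormSubgradient (φ : H → EReal) (x u : H) : Prop :=
  u ∈ subdiff φ x ∧ ∀ v ∈ subdiff φ x, ‖u‖ ≤ ‖v‖

/-- `p = prox_{β φ}(x)`, i.e. `p` minimizes `v ↦ β φ(v) + ½ ‖x - v‖²` over the whole space. For
`φ ∈ Γ₀(H)` and `β > 0` there is exactly one such `p`. -/
def IsProx (β : ℝ) (φ : H → EReal) (x p : H) : Prop :=
  IsMinOn (fun v => (β : EReal) * φ v + ((1 / 2 * ‖x - v‖ ^ 2 : ℝ) : EReal)) Set.univ p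

/-- `φ` is differentiable at `x` in the sense of Gateaux, with gradient `v`; the point has to be
interior to the domain. (Gateaux differentiability is implied by Fréchet differentiability, and the
gradients are then the same.) -/
def HasGradAt (φ : H → EReal) (v x : H) : Prop :=
  x ∈ interior (dom φ) ∧
    ∀ d : H, HasLineDerivAt ℝ (fun y => (φ y).toReal) (inner ℝ v d) x d

/-- Differentiability at a point. -/
def DiffAt (φ : H → EReal) (x : H) : Prop := ∃ v, HasGradAt φ v x

open Classical in
/-- The gradient `∇φ(x)` (with the value `0` where `φ` is not differentiable). -/
noncomputable def grad (φ : H → EReal) (x : H) : H :=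
  if h : DiffAt φ x then h.choose else 0

theorem HasGradAt.unique {φ : H → EReal} {v w x : H} (hv : HasGradAt φ v x)
    (hw : HasGradAt φ w x) : v = w := by
  refine ext_inner_right ℝ fun d => ?_
  rw [← (hv.2 d).lineDeriv, ← (hw.2 d).lineDeriv]

theorem HasGradAt.grad_eq {φ : H → EReal} {v x : H} (hv : HasGradAt φ v x) : grad φ x = v := by
  have h : DiffAt φ x := ⟨v, hv⟩
  rw [grad, dif_pos h]
  exact h.choose_spec.unique hv

/-- The Bregman divergence `D_G(x, y) = G(x) - G(y) - ⟨∇G(y), x - y⟩`. -/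
noncomputable def bregman (G : H → EReal) (x y : H) : EReal :=
  G x - G y - ((inner ℝ (grad G y) (x - y) : ℝ) : EReal)

/-- The curvature constant `K_{(G, ζ, C)}`, the supremum of `D_G(x + γ (s - x), x) / ζ(γ)` over
`x, s ∈ C` and `γ ∈ ]0, 1]`. It is computed in `[0, +∞]`, where `0 / 0 = 0` and `t / 0 = +∞` for
`t > 0`; replacing negative quotients by `0` does not change the supremum, because `s = x` gives
the quotient `0`. -/
noncomputable def curvature (G : H → EReal) (ζ : ℝ → ℝ) (C : Set H) : ENNReal :=
  ⨆ x ∈ C, ⨆ s ∈ C, ⨆ γ ∈ Set.Ioc (0 : ℝ) 1,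
    (bregman G (x + γ • (s - x)) x).toENNReal / ENNReal.ofReal (ζ γ)

/-- The pair `(φ, C)` is `(G, ζ)`-smooth. Only the values of `ζ` on `]0, 1]` matter. Convexity of
`G - φ` on the open set `C₀`, which need not be convex, is required on the segments contained in
`C₀` (for convex `C₀` this is convexity on `C₀`). -/
def IsSmoothPair (φ : H → EReal) (C : Set H) (G : H → EReal) (ζ : ℝ → ℝ) : Prop :=
  (∀ x, G x ≠ ⊥) ∧ (∀ γ ∈ Set.Ioc (0 : ℝ) 1, 0 ≤ ζ γ) ∧ C ⊆ dom φ ∧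
    ∃ C₀ : Set H, IsOpen C₀ ∧ C ⊆ C₀ ∧ C₀ ⊆ interior (dom G) ∧
      (∀ x ∈ C₀, DiffAt G x ∧ DiffAt φ x) ∧
      (∀ x ∈ C₀, ∀ y ∈ C₀, segment ℝ x y ⊆ C₀ →
        ConvexOn ℝ (segment ℝ x y) (fun z => (G z).toReal - (φ z).toReal)) ∧
      curvature G ζ C < ⊤

/-- Weak compactness of a set. -/
def IsWeaklyCompact (C : Set H) : Prop := IsCompact (toWeakSpace ℝ H '' C)

end ConvexAnalysis

section Problem

variable {Hp Hd Hv : Type*}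
  [NormedAddCommGroup Hp] [InnerProductSpace ℝ Hp] [CompleteSpace Hp]
  [NormedAddCommGroup Hd] [InnerProductSpace ℝ Hd] [CompleteSpace Hd]
  [NormedAddCommGroup Hv] [InnerProductSpace ℝ Hv] [CompleteSpace Hv]

/-- The Lagrangian `L(x, μ) = f(x) + g(Tx) + h(x) + ⟨μ, Ax - b⟩`. -/
noncomputable def lagrangian (f : Hp → EReal) (g : Hv → EReal) (h : Hp → EReal)
    (T : Hp →L[ℝ] Hv) (A : Hp →L[ℝ] Hd) (b : Hd) (x : Hp) (μ : Hd) : EReal :=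
  f x + g (T x) + h x + ((inner ℝ μ (A x - b) : ℝ) : EReal)

/-- `(xs, μs)` is a saddle point of `L`. -/
def IsSaddlePoint (L : Hp → Hd → EReal) (xs : Hp) (μs : Hd) : Prop :=
  ∀ x μ, L xs μ ≤ L xs μs ∧ L xs μs ≤ L x μs

/-- The assumptions on the functions of the problem
`min { f(x) + g(Tx) + h(x) : Ax = b }`, where `C = dom h`. -/
structure ProblemAssumptions (f : Hp → EReal) (g : Hv → EReal) (h : Hp → EReal)
    (T : Hp →L[ℝ] Hv) (A : Hp →L[ℝ] Hd) (b : Hd) (F : Hp → EReal) (ζ : ℝ → ℝ) : Prop where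
  g_gamma0 : Gamma0 g
  f_gamma0 : Gamma0 f
  gT_gamma0 : Gamma0 (fun x => g (T x))
  h_gamma0 : Gamma0 h
  smooth : IsSmoothPair f (dom h) F ζ
  compact : IsWeaklyCompact (dom h)
  subdiff_nonempty : T '' dom h ⊆ domSubdiff g
  subdiff_bounded : ∃ M : ℝ, ∀ x ∈ dom h, ∃ u, IsMinNormSubgradient g (T x) u ∧ ‖u‖ ≤ M
  saddle : ∃ xs μs, IsSaddlePoint (lagrangian f g h T A b) xs μs

/-- The assumptions on the parameter sequences: `γlo`, `γhi` bound the ratios of consecutive step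
sizes, `ρlo`, `ρhi` are the infimum and the supremum of the penalties `ρ`, and `c` is the ratio of
the primal to the dual step sizes. -/
structure ParameterAssumptions (ζ : ℝ → ℝ) (γ β θ ρ : ℕ → ℝ) (γlo γhi ρlo ρhi c : ℝ) : Prop where
  γ_mem : ∀ k, γ k ∈ Set.Ioc (0 : ℝ) 1
  β_pos : ∀ k, 0 < β k
  summable_ζ : Summable (fun k => ζ (γ k))
  summable_sq_div : Summable (fun k => γ k ^ 2 / β k)
  summable_mul : Summable (fun k => γ k * β k)
  not_summable : ¬ Summable γ
  β_antitone : Antitone β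
  β_tendsto : Tendsto β atTop (𝓝 0)
  ρ_monotone : Monotone ρ
  ρlo_pos : 0 < ρlo
  ρ_inf : IsGLB (Set.range ρ) ρlo
  ρ_sup : IsLUB (Set.range ρ) ρhi
  γlo_pos : 0 < γlo
  γhi_pos : 0 < γhi
  γ_ratio : ∀ k, γlo ≤ γ k / γ (k + 1) ∧ γ k / γ (k + 1) ≤ γhi
  c_pos : 0 < c
  θ_eq : ∀ k, θ k = γ k / c
  c_large : γhi / c - ρlo / 2 < 0

/-- The sequences `x, y, z, s, μ` are produced by the CGALP algorithm (conditional gradient with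
augmented Lagrangian and proximal step) with the parameters `γ, β, θ, ρ`. -/
structure IsCGALP (f : Hp → EReal) (g : Hv → EReal) (h : Hp → EReal)
    (T : Hp →L[ℝ] Hv) (A : Hp →L[ℝ] Hd) (b : Hd) (γ β θ ρ : ℕ → ℝ)
    (x : ℕ → Hp) (y : ℕ → Hv) (z s : ℕ → Hp) (μ : ℕ → Hd) : Prop where
  x_zero : x 0 ∈ dom h
  μ_zero : μ 0 ∈ Set.range A
  y_step : ∀ k, IsProx (β k) g (T (x k)) (y k)
  z_step : ∀ k, z k = grad f (x k)
    + (1 / β k) • ContinuousLinearMap.adjoint T (T (x k) - y k)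
    + ContinuousLinearMap.adjoint A (μ k)
    + ρ k • ContinuousLinearMap.adjoint A (A (x k) - b)
  s_step : ∀ k, IsMinOn (fun v => h v + ((inner ℝ (z k) v : ℝ) : EReal)) Set.univ (s k)
  x_step : ∀ k, x (k + 1) = x k - γ k • (x k - s k)
  μ_step : ∀ k, μ (k + 1) = μ k + θ k • (A (x (k + 1)) - b)

end Problem

/-- `Γ_k = γ_0 + ⋯ + γ_k`. -/
noncomputable def cumStep (γ : ℕ → ℝ) (k : ℕ) : ℝ := ∑ i ∈ Finset.range (k + 1), γ i

/-- The ergodic average `(γ_0 x_0 + ⋯ + γ_k x_k) / Γ_k`. -/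
noncomputable def ergodicAverage {H : Type*} [NormedAddCommGroup H] [InnerProductSpace ℝ H]
    (γ : ℕ → ℝ) (x : ℕ → H) (k : ℕ) : H :=
  (cumStep γ k)⁻¹ • ∑ i ∈ Finset.range (k + 1), γ i • x i

end CGALP

namespace CGALP

/-! Write `r k = A (x k) - b`, let `(xs, μs)` be a saddle point and `ν k = μ k - μs`. Everything
follows from summability of `γ k * ‖r k‖ ^ 2`. Replace `g` by its Moreau envelope of index `β k`;
its gradient at `T (x k)` is the one used in `z k`. Let `D k` be the gap of the smoothed Lagrangian
at `μs`. The bound on minimal subgradients and the saddle point give `D k ≥ -O(β k)`. One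
conditional gradient step contracts `D` by `1 - γ k`, up to multiplier and penalty terms and a
summable error (`IsCGALP.step`). Adding `⟪ν k, r k⟫ + ρ k / 2 * ‖r k‖ ^ 2 + c / 2 * ‖ν k‖ ^ 2` to `D
k` cancels the first-order cross terms. What remains is a decrease of order `γ k * ‖r k‖ ^ 2` and an
`O(γ k ^ 2)` perturbation involving the possibly large `ν k`, which a Robbins–Siegmund argument
absorbs (`summable_mul_norm_residual_sq`). Convergence then comes from the increments of `‖r k‖ ^ 2`
being `O(γ k)`, the two rates from Cauchy–Schwarz, and the subsequence from Abel–Dini. -/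

/-! ### Scalar recursions and series -/

theorem le_exp_sum_mul_of_le_one_add_mul_add {W α e : ℕ → ℝ} (hα : ∀ k, 0 ≤ α k)
    (he : ∀ k, 0 ≤ e k) (hW0 : 0 ≤ W 0) (hW : ∀ k, W (k + 1) ≤ (1 + α k) * W k + e k) (n : ℕ) :
    W n ≤ Real.exp (∑ i ∈ Finset.range n, α i) * (W 0 + ∑ i ∈ Finset.range n, e i) := by
  induction n with
  | zero => simp
  | succ n ih =>
    rw [Finset.sum_range_succ, Finset.sum_range_succ, Real.exp_add]
    set P := Real.exp (∑ i ∈ Finset.range n, α i)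
    set S := ∑ i ∈ Finset.range n, e i
    have hS : 0 ≤ S := Finset.sum_nonneg fun i _ => he i
    have hP : 1 ≤ P := Real.one_le_exp (Finset.sum_nonneg fun i _ => hα i)
    have h1 : 1 + α n ≤ Real.exp (α n) := by linarith [Real.add_one_le_exp (α n)]
    have h0 : 0 ≤ 1 + α n := by linarith [hα n]
    have h2 : 1 ≤ Real.exp (α n) := Real.one_le_exp (hα n)
    calc W (n + 1) ≤ (1 + α n) * W n + e n := hW n
      _ ≤ (1 + α n) * (P * (W 0 + S)) + e n := by gcongr
      _ ≤ Real.exp (α n) * (P * (W 0 + S)) + e n := by gcongr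
      _ ≤ Real.exp (α n) * (P * (W 0 + S)) + P * Real.exp (α n) * e n := by
          have : 1 * e n ≤ P * Real.exp (α n) * e n :=
            mul_le_mul_of_nonneg_right (one_le_mul_of_one_le_of_one_le hP h2) (he n)
          linarith
      _ = P * Real.exp (α n) * (W 0 + (S + e n)) := by ring

/-- A deterministic form of the Robbins–Siegmund lemma. -/
theorem summable_of_le_one_add_mul_sub_add {U α d e : ℕ → ℝ} (hU : ∀ k, 0 ≤ U k)
    (hα : ∀ k, 0 ≤ α k) (hd : ∀ k, 0 ≤ d k) (he : ∀ k, 0 ≤ e k) (hαs : Summable α)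
    (hes : Summable e) (h : ∀ k, U (k + 1) ≤ (1 + α k) * U k - d k + e k) : Summable d := by
  -- Adding the accumulated decrease to `U` leaves a recursion without `d`; a bound on `W` then
  -- bounds the partial sums of `d`.
  let W : ℕ → ℝ := fun k => U k + ∑ i ∈ Finset.range k, d i
  have hW : ∀ k, W (k + 1) ≤ (1 + α k) * W k + e k := fun k => by
    have h1 : 0 ≤ α k * ∑ i ∈ Finset.range k, d i :=
      mul_nonneg (hα k) (Finset.sum_nonneg fun i _ => hd i)
    have h2 := h k
    simp only [W, Finset.sum_range_succ]
    linarith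
  have hW0 : 0 ≤ W 0 := by simpa [W] using hU 0
  refine summable_of_sum_range_le (c := Real.exp (∑' i, α i) * (W 0 + ∑' i, e i)) hd fun n => ?_
  calc ∑ i ∈ Finset.range n, d i ≤ W n := by simpa [W] using hU n
    _ ≤ _ := le_exp_sum_mul_of_le_one_add_mul_add hα he hW0 hW n
    _ ≤ _ := by
      have h1 := hαs.sum_le_tsum (Finset.range n) fun i _ => hα i
      have h2 := hes.sum_le_tsum (Finset.range n) fun i _ => he i
      have h3 : 0 ≤ ∑ i ∈ Finset.range n, e i := Finset.sum_nonneg fun i _ => he i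
      gcongr

theorem summable_sub_succ_of_antitone {u : ℕ → ℝ} {B : ℝ} (hu : Antitone u)
    (hB : ∀ k, B ≤ u k) : Summable fun k => u k - u (k + 1) := by
  refine summable_of_sum_range_le (c := u 0 - B) (fun k => sub_nonneg.2 (hu k.le_succ))
    fun n => ?_
  rw [Finset.sum_range_sub']
  linarith [hB n]

/-- The increments of `a ^ 2` are at most `2 * L * γ * a + L ^ 2 * γ ^ 2`, which is summable, so `a
^ 2` converges. A positive limit would make `γ` eventually at most a constant times `γ * a`, hence
summable. -/
theorem tendsto_zero_of_summable_mul {γ a : ℕ → ℝ} {L : ℝ} (hγ : ∀ k, 0 ≤ γ k)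
    (ha : ∀ k, 0 ≤ a k) (hns : ¬ Summable γ) (hsq : Summable fun k => γ k ^ 2)
    (hs : Summable fun k => γ k * a k) (hL : ∀ k, |a (k + 1) - a k| ≤ L * γ k) :
    Tendsto a atTop (𝓝 0) := by
  have he : Summable fun k => 2 * L * (γ k * a k) + L ^ 2 * γ k ^ 2 :=
    (hs.mul_left _).add (hsq.mul_left _)
  have hc : CauchySeq fun k => a k ^ 2 := by
    refine cauchySeq_of_dist_le_of_summable _ (fun k => ?_) he
    rw [Real.dist_eq, abs_sub_comm]
    have h1 : a (k + 1) ^ 2 - a k ^ 2 = (a (k + 1) - a k) * (a (k + 1) + a k) := by ring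
    rw [h1, abs_mul, abs_of_nonneg (add_nonneg (ha _) (ha _))]
    have h2 : a (k + 1) ≤ a k + L * γ k := by linarith [le_abs_self (a (k + 1) - a k), hL k]
    have h3 : 0 ≤ L * γ k := (abs_nonneg _).trans (hL k)
    calc |a (k + 1) - a k| * (a (k + 1) + a k) ≤ L * γ k * (2 * a k + L * γ k) := by
          apply mul_le_mul (hL k) (by linarith) (add_nonneg (ha _) (ha _)) h3
      _ = _ := by ring
  obtain ⟨l, hl⟩ := cauchySeq_tendsto_of_complete hc
  have hl' : Tendsto a atTop (𝓝 √l) := by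
    have := (Real.continuous_sqrt.tendsto l).comp hl
    refine this.congr fun k => ?_
    simp [Real.sqrt_sq (ha k)]
  rcases (Real.sqrt_nonneg l).eq_or_lt with h0 | h0
  · rwa [← h0] at hl'
  · exfalso
    apply hns
    obtain ⟨N, hN⟩ := eventually_atTop.1 (hl'.eventually (eventually_ge_nhds (half_lt_self h0)))
    rw [← summable_nat_add_iff N]
    refine Summable.of_nonneg_of_le (fun k => hγ _) (fun k => ?_)
      (((summable_nat_add_iff N).2 hs).mul_left (2 / √l))
    have := hN (k + N) (by omega)
    have h4 : γ (k + N) * (√l / 2) ≤ γ (k + N) * a (k + N) :=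
      mul_le_mul_of_nonneg_left this (hγ _)
    calc γ (k + N) = 2 / √l * (γ (k + N) * (√l / 2)) := by field_simp
      _ ≤ _ := by gcongr

/-! ### Rates in terms of the cumulative step -/

theorem cumStep_pos {γ : ℕ → ℝ} (hγ : ∀ k, 0 < γ k) (k : ℕ) : 0 < cumStep γ k :=
  Finset.sum_pos (fun i _ => hγ i) ⟨0, by simp⟩

theorem tendsto_cumStep_atTop {γ : ℕ → ℝ} (hγ : ∀ k, 0 < γ k) (hns : ¬ Summable γ) :
    Tendsto (cumStep γ) atTop atTop :=
  ((not_summable_iff_tendsto_nat_atTop_of_nonneg fun k => (hγ k).le).1 hns).comp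
    (tendsto_add_atTop_nat 1)

/-- A divergent series of positive terms still diverges after division by its partial sums
(Abel–Dini). -/
theorem not_summable_div_cumStep {γ : ℕ → ℝ} (hγ : ∀ k, 0 < γ k) (hns : ¬ Summable γ) :
    ¬ Summable fun k => γ k / cumStep γ k := by
  intro hs
  have ht := tendsto_cumStep_atTop hγ hns
  -- If the tail beyond `N` is below `1 / 2`, then `Γ (N + n) - Γ N ≤ Γ (N + n) / 2`, so all later
  -- partial sums stay below `2 * Γ N`.
  obtain ⟨N, hN⟩ := (((tendsto_sum_nat_add fun k => γ k / cumStep γ k).comp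
    (tendsto_add_atTop_nat 1)).eventually (eventually_lt_nhds one_half_pos)).exists
  have hsplit : ∀ n, cumStep γ (N + n)
      = cumStep γ N + ∑ i ∈ Finset.range n, γ (i + (N + 1)) := fun n => by
    rw [cumStep, cumStep, show N + n + 1 = N + 1 + n by ring, Finset.sum_range_add]
    simp only [add_comm]
  have hb : ∀ n, cumStep γ (N + n) ≤ 2 * cumStep γ N := fun n => by
    have hpos := cumStep_pos hγ (N + n)
    have h1 : (∑ i ∈ Finset.range n, γ (i + (N + 1))) / cumStep γ (N + n) ≤ 1 / 2 := by
      rw [Finset.sum_div]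
      refine le_trans (Finset.sum_le_sum fun i hi => ?_)
        ((((summable_nat_add_iff (N + 1)).2 hs).sum_le_tsum (Finset.range n)
          fun i _ => (div_pos (hγ _) (cumStep_pos hγ _)).le).trans hN.le)
      refine div_le_div_of_nonneg_left (hγ _).le (cumStep_pos hγ _) ?_
      refine Finset.sum_le_sum_of_subset_of_nonneg (fun j hj => ?_) fun j _ _ => (hγ j).le
      simp only [Finset.mem_range] at hi hj ⊢
      omega
    rw [div_le_iff₀ hpos] at h1
    linarith [hsplit n]
  obtain ⟨k, hk⟩ := ((ht.eventually_gt_atTop (2 * cumStep γ N)).and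
    (eventually_ge_atTop N)).exists
  obtain ⟨n, rfl⟩ := Nat.exists_eq_add_of_le hk.2
  exact (hb n).not_gt hk.1

/-- If the bound failed from some index on, `γ / Γ` would be dominated by the summable `γ * a ^ 2`,
against Abel–Dini. This gives the constant `1` exactly. -/
theorem exists_strictMono_le_inv_sqrt_cumStep {γ a : ℕ → ℝ} (hγ : ∀ k, 0 < γ k)
    (hns : ¬ Summable γ) (hs : Summable fun k => γ k * a k ^ 2) :
    ∃ φ : ℕ → ℕ, StrictMono φ ∧ ∀ j, a (φ j) ≤ 1 / √(cumStep γ (φ j)) := by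
  refine extraction_of_frequently_atTop (P := fun k => a k ≤ 1 / √(cumStep γ k))
    fun hev => not_summable_div_cumStep hγ hns ?_
  obtain ⟨N, hN⟩ := eventually_atTop.1 hev
  rw [← summable_nat_add_iff N]
  refine Summable.of_nonneg_of_le (fun k => (div_pos (hγ _) (cumStep_pos hγ _)).le)
    (fun k => ?_) ((summable_nat_add_iff N).2 hs)
  have h1 := not_le.1 (hN (k + N) (by omega))
  have h2 : 1 / cumStep γ (k + N) ≤ a (k + N) ^ 2 := by
    have := pow_le_pow_left₀ (by positivity) h1.le 2
    rwa [div_pow, one_pow, Real.sq_sqrt (cumStep_pos hγ _).le] at this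
  rw [div_eq_mul_one_div]
  exact mul_le_mul_of_nonneg_left h2 (hγ _).le

/-- Cauchy–Schwarz for `√γ` and `√γ * a`; both rates reduce to it. -/
theorem sum_mul_le_sqrt_cumStep {γ a : ℕ → ℝ} (hγ : ∀ k, 0 < γ k)
    (hs : Summable fun k => γ k * a k ^ 2) (k : ℕ) :
    ∑ i ∈ Finset.range (k + 1), γ i * a i ≤ √(cumStep γ k) * √(∑' i, γ i * a i ^ 2) := by
  have h1 := Real.sum_mul_le_sqrt_mul_sqrt (Finset.range (k + 1)) (fun i => √(γ i))
    (fun i => √(γ i) * a i)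
  have h2 : ∀ i, √(γ i) * (√(γ i) * a i) = γ i * a i := fun i => by
    rw [← mul_assoc, Real.mul_self_sqrt (hγ i).le]
  have h3 : ∀ i, (√(γ i) * a i) ^ 2 = γ i * a i ^ 2 := fun i => by
    rw [mul_pow, Real.sq_sqrt (hγ i).le]
  have h4 : ∀ i, √(γ i) ^ 2 = γ i := fun i => Real.sq_sqrt (hγ i).le
  simp only [h2, h3, h4] at h1
  refine h1.trans (mul_le_mul_of_nonneg_left (Real.sqrt_le_sqrt ?_) (Real.sqrt_nonneg _))
  exact hs.sum_le_tsum _ fun i _ => mul_nonneg (hγ i).le (sq_nonneg _)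

theorem isBigO_inv_sqrt_of_cumStep_mul_le {γ u : ℕ → ℝ} {S : ℝ} (hγ : ∀ k, 0 < γ k)
    (hu : ∀ k, 0 ≤ u k) (h : ∀ k, cumStep γ k * u k ≤ √(cumStep γ k) * S) :
    u =O[atTop] fun k => 1 / √(cumStep γ k) := by
  refine IsBigO.of_bound S (Eventually.of_forall fun k => ?_)
  have hp := Real.sqrt_pos.2 (cumStep_pos hγ k)
  rw [Real.norm_of_nonneg (hu k), Real.norm_of_nonneg (by positivity), mul_one_div,
    le_div_iff₀ hp]
  have h1 := h k
  nth_rewrite 1 [← Real.mul_self_sqrt (cumStep_pos hγ k).le] at h1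
  rw [mul_assoc] at h1
  linarith [le_of_mul_le_mul_left h1 hp]

theorem isBigO_inf'_inv_sqrt_cumStep {γ a : ℕ → ℝ} (hγ : ∀ k, 0 < γ k) (ha : ∀ k, 0 ≤ a k)
    (hs : Summable fun k => γ k * a k ^ 2) :
    (fun k => (Finset.range (k + 1)).inf' Finset.nonempty_range_add_one a)
      =O[atTop] fun k => 1 / √(cumStep γ k) := by
  refine isBigO_inv_sqrt_of_cumStep_mul_le hγ
    (fun k => Finset.le_inf' _ _ fun i _ => ha i)
    fun k => le_trans ?_ (sum_mul_le_sqrt_cumStep hγ hs k)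
  rw [cumStep, Finset.sum_mul]
  exact Finset.sum_le_sum fun i hi =>
    mul_le_mul_of_nonneg_left (Finset.inf'_le _ hi) (hγ i).le

theorem isBigO_ergodicAverage {H H' : Type*} [NormedAddCommGroup H] [InnerProductSpace ℝ H]
    [NormedAddCommGroup H'] [InnerProductSpace ℝ H'] (A : H →L[ℝ] H') (b : H') {x : ℕ → H}
    {γ : ℕ → ℝ} (hγ : ∀ k, 0 < γ k) (hs : Summable fun k => γ k * ‖A (x k) - b‖ ^ 2) :
    (fun k => ‖A (ergodicAverage γ x k) - b‖) =O[atTop] fun k => 1 / √(cumStep γ k) := by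
  refine isBigO_inv_sqrt_of_cumStep_mul_le hγ (fun k => norm_nonneg _)
    fun k => le_trans ?_ (sum_mul_le_sqrt_cumStep hγ hs k)
  have hp := cumStep_pos hγ k
  have h1 : cumStep γ k • (A (ergodicAverage γ x k) - b)
      = ∑ i ∈ Finset.range (k + 1), γ i • (A (x i) - b) := by
    rw [ergodicAverage, map_smul, smul_sub, smul_inv_smul₀ hp.ne', map_sum, cumStep,
      Finset.sum_smul, ← Finset.sum_sub_distrib]
    simp only [map_smul, smul_sub]
  calc cumStep γ k * ‖A (ergodicAverage γ x k) - b‖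
      = ‖cumStep γ k • (A (ergodicAverage γ x k) - b)‖ := by
        rw [norm_smul, Real.norm_of_nonneg hp.le]
    _ ≤ ∑ i ∈ Finset.range (k + 1), ‖γ i • (A (x i) - b)‖ := h1 ▸ norm_sum_le _ _
    _ = _ := Finset.sum_congr rfl fun i _ => by
        rw [norm_smul, Real.norm_of_nonneg (hγ i).le]

/-! ### Convex analysis of extended-real-valued functions -/

section
variable {H : Type*} [NormedAddCommGroup H] [InnerProductSpace ℝ H]

theorem Gamma0.coe_toReal {φ : H → EReal} (hφ : Gamma0 φ) {x : H} (hx : x ∈ dom φ) :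
    ((φ x).toReal : EReal) = φ x :=
  EReal.coe_toReal (ne_of_lt hx) (hφ.ne_bot x)

theorem Gamma0.convex_coe {φ : H → EReal} (hφ : Gamma0 φ) {x y : H} (hx : x ∈ dom φ)
    (hy : y ∈ dom φ) {s t : ℝ} (hs : 0 ≤ s) (ht : 0 ≤ t) (hst : s + t = 1) :
    φ (s • x + t • y) ≤ ((s * (φ x).toReal + t * (φ y).toReal : ℝ) : EReal) := by
  have h := hφ.convex x y s t hs ht hst
  rw [← hφ.coe_toReal hx, ← hφ.coe_toReal hy] at h
  exact_mod_cast h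

theorem Gamma0.convexOn_toReal {φ : H → EReal} (hφ : Gamma0 φ) :
    ConvexOn ℝ (dom φ) fun x => (φ x).toReal := by
  have hmem : Convex ℝ (dom φ) := fun x hx y hy s t hs ht hst =>
    (hφ.convex_coe hx hy hs ht hst).trans_lt (EReal.coe_lt_top _)
  refine ⟨hmem, fun x hx y hy s t hs ht hst => ?_⟩
  have h := hφ.convex_coe hx hy hs ht hst
  rw [← hφ.coe_toReal (hmem hx hy hs ht hst)] at h
  exact_mod_cast h

/-- The derivative is the limit of difference quotients, each at most `φ y - φ x` by convexity. Only
the segment matters, so this also serves `F - f`, which is convex only on segments. -/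
theorem _root_.ConvexOn.add_lineDeriv_le {φ : H → ℝ} {x y : H} {d : ℝ}
    (hφ : ConvexOn ℝ (segment ℝ x y) φ) (hd : HasLineDerivAt ℝ φ d x (y - x)) :
    φ x + d ≤ φ y := by
  have ht : Tendsto (fun t : ℝ => t⁻¹ • (φ (x + t • (y - x)) - φ x)) (𝓝[>] 0) (𝓝 d) :=
    hd.tendsto_slope_zero_right
  have : d ≤ φ y - φ x := by
    refine le_of_tendsto ht ?_
    filter_upwards [Ioo_mem_nhdsGT (zero_lt_one (α := ℝ))] with t ht
    have h := hφ.2 (left_mem_segment ℝ x y) (right_mem_segment ℝ x y)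
      (sub_nonneg.2 ht.2.le) ht.1.le (sub_add_cancel 1 t)
    rw [show (1 - t) • x + t • y = x + t • (y - x) by module, smul_eq_mul, smul_eq_mul] at h
    rw [smul_eq_mul, inv_mul_le_iff₀ ht.1]
    linarith
  linarith

theorem Gamma0.add_inner_le {φ : H → EReal} (hφ : Gamma0 φ) {x y v : H} (hx : x ∈ dom φ)
    (hy : y ∈ dom φ) (hv : HasGradAt φ v x) :
    (φ x).toReal + inner ℝ v (y - x) ≤ (φ y).toReal :=
  (hφ.convexOn_toReal.subset (hφ.convexOn_toReal.1.segment_subset hx hy)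
    (convex_segment x y)).add_lineDeriv_le (hv.2 (y - x))

theorem toReal_add_inner_le_of_mem_subdiff {φ : H → EReal} (hφ : Gamma0 φ) {x u y : H}
    (hx : x ∈ dom φ) (hu : u ∈ subdiff φ x) (hy : y ∈ dom φ) :
    (φ x).toReal + inner ℝ u (y - x) ≤ (φ y).toReal := by
  have h := hu y
  rw [← hφ.coe_toReal hx, ← hφ.coe_toReal hy] at h
  exact_mod_cast h

theorem Gamma0.mem_dom_of_mem_subdiff {φ : H → EReal} (hφ : Gamma0 φ) {x u : H}
    (hu : u ∈ subdiff φ x) : x ∈ dom φ := by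
  obtain ⟨y, hy⟩ := hφ.proper
  have h := (hu y).trans_lt hy
  refine (lt_top_iff_ne_top (α := EReal)).2 fun hx => ?_
  rw [hx, EReal.top_add_coe] at h
  exact h.ne rfl

theorem nonpos_of_forall_le_mul {a C : ℝ} (h : ∀ t ∈ Set.Ioo (0 : ℝ) 1, a ≤ t * C) : a ≤ 0 := by
  have ht : Tendsto (fun t : ℝ => t * C) (𝓝[>] 0) (𝓝 0) := by
    have : Tendsto (fun t : ℝ => t * C) (𝓝 0) (𝓝 (0 * C)) := tendsto_id.mul_const C
    rw [zero_mul] at this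
    exact this.mono_left nhdsWithin_le_nhds
  refine ge_of_tendsto ht ?_
  filter_upwards [Ioo_mem_nhdsGT (zero_lt_one (α := ℝ))] with t ht using h t ht

/-! ### Proximal points and the Moreau envelope -/

theorem IsProx.mem_dom {φ : H → EReal} (hφ : Gamma0 φ) {β : ℝ} (hβ : 0 < β) {x p : H}
    (hp : IsProx β φ x p) : p ∈ dom φ := by
  obtain ⟨y, hy⟩ := hφ.proper
  refine (lt_top_iff_ne_top (α := EReal)).2 fun hx => ?_
  have h := hp (Set.mem_univ y)
  simp only [Set.mem_ofPred_eq] at h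
  rw [hx, EReal.coe_mul_top_of_pos hβ, EReal.top_add_coe, ← hφ.coe_toReal hy] at h
  exact absurd (top_le_iff.1 h) (by exact_mod_cast EReal.coe_ne_top _)

theorem IsProx.toReal_le {φ : H → EReal} (hφ : Gamma0 φ) {β : ℝ} (hβ : 0 < β) {x p y : H}
    (hp : IsProx β φ x p) (hy : y ∈ dom φ) :
    β * (φ p).toReal + 1 / 2 * ‖x - p‖ ^ 2 ≤ β * (φ y).toReal + 1 / 2 * ‖x - y‖ ^ 2 := by
  have h := hp (Set.mem_univ y)
  simp only [Set.mem_ofPred_eq] at h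
  rw [← hφ.coe_toReal hy, ← hφ.coe_toReal (hp.mem_dom hφ hβ)] at h
  exact_mod_cast h

/-- The optimality condition of the proximal step: `(x - p) / β` is a subgradient at `p`. -/
theorem IsProx.add_inner_le {φ : H → EReal} (hφ : Gamma0 φ) {β : ℝ} (hβ : 0 < β) {x p y : H}
    (hp : IsProx β φ x p) (hy : y ∈ dom φ) :
    (φ p).toReal + inner ℝ ((1 / β) • (x - p)) (y - p) ≤ (φ y).toReal := by
  have hpd := hp.mem_dom hφ hβ
  have key : β * ((φ p).toReal - (φ y).toReal) + inner ℝ (x - p) (y - p) ≤ 0 := by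
    -- Compare `p` with the competitor `(1 - t) • p + t • y` and divide by `t`: the quadratic
    -- remainder is `t` times this constant and vanishes as `t → 0`.
    refine nonpos_of_forall_le_mul (C := 1 / 2 * ‖y - p‖ ^ 2) fun t ht => ?_
    have hc := hφ.convexOn_toReal.2 hpd hy (sub_nonneg.2 ht.2.le) ht.1.le (sub_add_cancel 1 t)
    have hd := hφ.convexOn_toReal.1 hpd hy (sub_nonneg.2 ht.2.le) ht.1.le (sub_add_cancel 1 t)
    have h := hp.toReal_le hφ hβ hd
    rw [show x - ((1 - t) • p + t • y) = (x - p) - t • (y - p) by module,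
      norm_sub_sq_real (x - p) (t • (y - p)), inner_smul_right, norm_smul, mul_pow,
      Real.norm_eq_abs, sq_abs] at h
    simp only [smul_eq_mul] at hc
    have h2 := mul_le_mul_of_nonneg_left hc hβ.le
    refine le_of_mul_le_mul_left ?_ ht.1
    linarith
  rw [real_inner_smul_left]
  have : β * ((φ p).toReal - (φ y).toReal + 1 / β * inner ℝ (x - p) (y - p)) ≤ β * 0 := by
    rw [mul_zero, mul_add, ← mul_assoc, mul_one_div_cancel hβ.ne', one_mul]
    exact key
  linarith [le_of_mul_le_mul_left this hβ]

/-- The value at `x` of the Moreau envelope of `φ` of index `β`, in terms of `p = prox_{β φ}(x)`. -/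
noncomputable def moreauValue (β : ℝ) (φ : H → EReal) (x p : H) : ℝ :=
  (φ p).toReal + 1 / (2 * β) * ‖x - p‖ ^ 2

/-- The vector `(1 / β) • (x - p)` is the gradient of the envelope at `x`, and the envelope lies
below `φ`. -/
theorem IsProx.moreauValue_add_inner_le {φ : H → EReal} (hφ : Gamma0 φ) {β : ℝ} (hβ : 0 < β)
    {x p y : H} (hp : IsProx β φ x p) (hy : y ∈ dom φ) :
    moreauValue β φ x p + inner ℝ ((1 / β) • (x - p)) (y - x) ≤ (φ y).toReal := by
  have h := hp.add_inner_le hφ hβ hy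
  rw [show y - p = (y - x) + (x - p) by abel, inner_add_right, real_inner_smul_left _ (x - p),
    real_inner_self_eq_norm_sq] at h
  have : 1 / (2 * β) * ‖x - p‖ ^ 2 ≤ 1 / β * ‖x - p‖ ^ 2 := by
    gcongr
    linarith
  rw [moreauValue]
  linarith

/-- Monotonicity of the subdifferential between `x` and `p` gives `‖q‖ ^ 2 ≤ ⟪u, q⟫` for `q = (1 /
β) • (x - p)`. The envelope gradients are thus bounded independently of `β`. -/
theorem IsProx.norm_smul_sub_le {φ : H → EReal} (hφ : Gamma0 φ) {β : ℝ} (hβ : 0 < β)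
    {x p u : H} (hp : IsProx β φ x p) (hu : u ∈ subdiff φ x) :
    ‖(1 / β) • (x - p)‖ ≤ ‖u‖ := by
  have hx := hφ.mem_dom_of_mem_subdiff hu
  have h1 := hp.add_inner_le hφ hβ hx
  have h2 := toReal_add_inner_le_of_mem_subdiff hφ hx hu (hp.mem_dom hφ hβ)
  set q := (1 / β) • (x - p) with hq
  have hxp : x - p = β • q := by rw [hq, smul_smul, mul_one_div_cancel hβ.ne', one_smul]
  rw [← neg_sub x p, inner_neg_right, hxp, inner_smul_right] at h2
  rw [hxp, inner_smul_right, real_inner_self_eq_norm_sq] at h1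
  have h3 : β * ‖q‖ ^ 2 ≤ β * inner ℝ u q := by linarith
  have h4 := (le_of_mul_le_mul_left h3 hβ).trans (real_inner_le_norm u q)
  rcases (norm_nonneg q).eq_or_lt with h0 | h0
  · rw [← h0]; exact norm_nonneg u
  · exact le_of_mul_le_mul_right (by linarith [sq ‖q‖]) h0

/-- Completing the square in the subgradient inequality at `x`: smoothing lowers the value by only
`O(β)`. -/
theorem IsProx.le_moreauValue {φ : H → EReal} (hφ : Gamma0 φ) {β : ℝ} (hβ : 0 < β)
    {x p u : H} (hp : IsProx β φ x p) (hu : u ∈ subdiff φ x) :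
    (φ x).toReal - β / 2 * ‖u‖ ^ 2 ≤ moreauValue β φ x p := by
  have hx := hφ.mem_dom_of_mem_subdiff hu
  have h2 := toReal_add_inner_le_of_mem_subdiff hφ hx hu (hp.mem_dom hφ hβ)
  have h3 : 0 ≤ 1 / (2 * β) * ‖β • u - (x - p)‖ ^ 2 := by positivity
  rw [norm_sub_sq_real, inner_smul_left, norm_smul, mul_pow, Real.norm_eq_abs, sq_abs] at h3
  have h4 : 1 / (2 * β) * (β ^ 2 * ‖u‖ ^ 2 - 2 * (β * inner ℝ u (x - p)) + ‖x - p‖ ^ 2)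
      = β / 2 * ‖u‖ ^ 2 - inner ℝ u (x - p) + 1 / (2 * β) * ‖x - p‖ ^ 2 := by
    field_simp
  rw [← neg_sub x p, inner_neg_right] at h2
  rw [moreauValue]
  simp only [conj_trivial] at h3
  linarith

/-- One step of the Moreau envelope: the point moves from `x` to `x'` and the index decreases from
`β` to `β'`. -/
theorem IsProx.moreauValue_step {φ : H → EReal} (hφ : Gamma0 φ) {β β' : ℝ} (hβ : 0 < β)
    (hβ' : 0 < β') (hle : β' ≤ β) {x x' p p' u : H} (hp : IsProx β φ x p)
    (hp' : IsProx β' φ x' p') (hu : u ∈ subdiff φ x') :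
    moreauValue β' φ x' p' ≤ moreauValue β φ x p + inner ℝ ((1 / β) • (x - p)) (x' - x)
      + 1 / (2 * β) * ‖x' - x‖ ^ 2 + (β - β') / 2 * ‖u‖ ^ 2 := by
  have h1 := hp'.add_inner_le hφ hβ' (hp.mem_dom hφ hβ)
  have hq := hp'.norm_smul_sub_le hφ hβ' hu
  set q := (1 / β') • (x' - p') with hqdef
  have hxp : x' - p' = β' • q := by rw [hqdef, smul_smul, mul_one_div_cancel hβ'.ne', one_smul]
  have hmv : moreauValue β' φ x' p' = (φ p').toReal + β' / 2 * ‖q‖ ^ 2 := by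
    rw [moreauValue, hxp, norm_smul, mul_pow, Real.norm_eq_abs, sq_abs]
    field_simp
  have hsq : ‖q‖ ^ 2 ≤ ‖u‖ ^ 2 := by gcongr
  have hsq' : (β - β') / 2 * ‖q‖ ^ 2 ≤ (β - β') / 2 * ‖u‖ ^ 2 :=
    mul_le_mul_of_nonneg_left hsq (by linarith)
  rw [show p - p' = (x' - p') - (x' - p) by abel, hxp, inner_sub_right, inner_smul_right,
    real_inner_self_eq_norm_sq] at h1
  -- Young's inequality with the old index `β`, so that `‖x' - p‖ ^ 2` carries the weight of the old
  -- envelope; the mismatch with `β'` costs `(β - β') / 2 * ‖q‖ ^ 2`, which telescopes over the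
  -- iteration.
  have h3 : 0 ≤ 1 / (2 * β) * ‖β • q - (x' - p)‖ ^ 2 := by positivity
  rw [norm_sub_sq_real, inner_smul_left, norm_smul, mul_pow, Real.norm_eq_abs, sq_abs] at h3
  have h4 : 1 / (2 * β) * (β ^ 2 * ‖q‖ ^ 2 - 2 * (β * inner ℝ q (x' - p)) + ‖x' - p‖ ^ 2)
      = β / 2 * ‖q‖ ^ 2 - inner ℝ q (x' - p) + 1 / (2 * β) * ‖x' - p‖ ^ 2 := by
    field_simp
  simp only [conj_trivial] at h3
  have h5 : 1 / (2 * β) * ‖x' - p‖ ^ 2 = 1 / (2 * β) * ‖x - p‖ ^ 2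
      + inner ℝ ((1 / β) • (x - p)) (x' - x) + 1 / (2 * β) * ‖x' - x‖ ^ 2 := by
    rw [show x' - p = (x - p) + (x' - x) by abel, norm_add_sq_real, real_inner_smul_left]
    field_simp
  rw [hmv, moreauValue]
  linarith

/-! ### Smoothness and boundedness of the domain -/

/-- The descent inequality of a smooth pair. -/
theorem IsSmoothPair.descent {φ G : H → EReal} {C : Set H} {ζ : ℝ → ℝ}
    (hs : IsSmoothPair φ C G ζ) (hC : Convex ℝ C) {x s : H} (hx : x ∈ C) (hsC : s ∈ C) {t : ℝ}
    (ht : t ∈ Set.Ioc (0 : ℝ) 1) :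
    (φ (x + t • (s - x))).toReal ≤ (φ x).toReal + t * inner ℝ (grad φ x) (s - x)
      + (curvature G ζ C).toReal * ζ t := by
  obtain ⟨hbot, hζ, -, C₀, -, hCC, hC₀, hdiff, hconv, hcurv⟩ := hs
  have hz : x + t • (s - x) ∈ C := hC.add_smul_sub_mem hx hsC ⟨ht.1.le, ht.2⟩
  set z := x + t • (s - x) with hzdef
  have hseg := hC.segment_subset hx hz
  have hcv := hconv x (hCC hx) z (hCC hz) (hseg.trans hCC)
  obtain ⟨⟨v, hv⟩, w, hw⟩ := hdiff x (hCC hx)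
  -- Convexity of `G - φ` on the segment says that the Bregman divergence of `φ` is at most that of
  -- `G`, which the curvature constant controls.
  have h1 := hcv.add_lineDeriv_le ((hv.2 (z - x)).sub (hw.2 (z - x)))
  rw [hw.grad_eq]
  have hzx : z - x = t • (s - x) := by rw [hzdef]; abel
  have hreal : ∀ y ∈ C, ((G y).toReal : EReal) = G y := fun y hy =>
    EReal.coe_toReal (ne_of_lt (show y ∈ dom G from interior_subset (hC₀ (hCC hy)))) (hbot y)
  have hb : bregman G z x
      = (((G z).toReal - (G x).toReal - inner ℝ v (z - x) : ℝ) : EReal) := by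
    rw [bregman, hv.grad_eq, ← hreal z hz, ← hreal x hx]
    norm_cast
  have h2 : (bregman G z x).toENNReal / ENNReal.ofReal (ζ t) ≤ curvature G ζ C :=
    le_iSup₂_of_le x hx <| le_iSup₂_of_le s hsC <| le_iSup₂_of_le t ht le_rfl
  rw [ENNReal.div_le_iff_le_mul (Or.inr hcurv.ne) (Or.inl ENNReal.ofReal_ne_top), hb,
    EReal.toENNReal_of_ne_top (EReal.coe_ne_top _), EReal.toReal_coe,
    ← ENNReal.ofReal_toReal hcurv.ne, ← ENNReal.ofReal_mul ENNReal.toReal_nonneg,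
    ENNReal.ofReal_le_ofReal_iff (mul_nonneg ENNReal.toReal_nonneg (hζ t ht))] at h2
  rw [hzx, inner_smul_right, inner_smul_right] at h1
  rw [hzx, inner_smul_right] at h2
  linarith

/-- Each functional `⟪y, ·⟫` is weakly continuous, hence bounded on `C`; the uniform boundedness
principle does the rest. -/
theorem IsWeaklyCompact.exists_norm_le [CompleteSpace H] {C : Set H} (hC : IsWeaklyCompact C) :
    ∃ R, ∀ x ∈ C, ‖x‖ ≤ R := by
  have hpt : ∀ y : H, ∃ B, ∀ i : C, ‖innerSL ℝ (i : H) y‖ ≤ B := fun y => by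
    have hc : Continuous fun w : WeakSpace ℝ H => innerSL ℝ y ((toWeakSpace ℝ H).symm w) :=
      WeakBilin.eval_continuous _ (innerSL ℝ y)
    obtain ⟨B, hB⟩ := (hC.image hc).isBounded.exists_norm_le
    refine ⟨B, fun i => ?_⟩
    have := hB _ ⟨_, ⟨i, i.2, rfl⟩, rfl⟩
    simpa [real_inner_comm] using this
  obtain ⟨R, hR⟩ := banach_steinhaus hpt
  exact ⟨R, fun x hx => by simpa [innerSL_apply_norm] using hR ⟨x, hx⟩⟩

end

/-! ### The Lyapunov argument -/

/-- The Lyapunov argument: `D` is the smoothed Lagrangian gap at the optimal multiplier, `r` the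
residual of the constraint and `ν` the distance of the multipliers to the optimal one. -/
theorem summable_mul_norm_residual_sq {H : Type*} [NormedAddCommGroup H] [InnerProductSpace ℝ H]
    {D γ ρ ε E : ℕ → ℝ} {r ν : ℕ → H} {c ρlo ρhi R ε₀ : ℝ} (hc : 0 < c) (hcρ : 2 ≤ c * ρlo)
    (hρlo : 0 < ρlo) (hρ : Monotone ρ) (hρ_lo : ∀ k, ρlo ≤ ρ k) (hρ_hi : ∀ k, ρ k ≤ ρhi)
    (hγ : ∀ k, 0 < γ k) (hγ_sq : Summable fun k => γ k ^ 2)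
    (hε : ∀ k, 0 ≤ ε k) (hε₀ : ∀ k, ε k ≤ ε₀) (hγε : Summable fun k => γ k * ε k)
    (hE : ∀ k, 0 ≤ E k) (hEs : Summable E)
    (hr : ∀ k, ‖r k‖ ≤ R) (hΔ : ∀ k, ‖r (k + 1) - r k‖ ≤ R * γ k)
    (hν : ∀ k, ν (k + 1) = ν k + (γ k / c) • r (k + 1))
    (hlow : ∀ k, -ε k ≤ D k)
    (hD : ∀ k, D (k + 1) ≤ (1 - γ k) * D k - γ k * inner ℝ (ν k) (r k)
      - inner ℝ (ν k) (r (k + 1) - r k) - γ k * ρ k * ‖r k‖ ^ 2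
      - ρ k * inner ℝ (r k) (r (k + 1) - r k) + E k) :
    Summable fun k => γ k * ‖r k‖ ^ 2 := by
  have hR : 0 ≤ R := (norm_nonneg _).trans (hr 0)
  have hρpos : ∀ k, 0 < ρ k := fun k => hρlo.trans_le (hρ_lo k)
  have hε₀' : 0 ≤ ε₀ := (hε 0).trans (hε₀ 0)
  have hρhi : 0 ≤ ρhi := (hρpos 0).le.trans (hρ_hi 0)
  -- The constant makes `U` nonnegative: `ε₀` offsets the negative part of `D`, and `R ^ 2 / c`
  -- completes the square of `c / 4 * ‖ν‖ ^ 2 - R * ‖ν‖`. The other `c / 4 * ‖ν‖ ^ 2` is kept, so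
  -- `U` controls the multipliers.
  let U : ℕ → ℝ := fun k => D k + inner ℝ (ν k) (r k) + ρ k / 2 * ‖r k‖ ^ 2
    + c / 2 * ‖ν k‖ ^ 2 + (ε₀ + R ^ 2 / c)
  have hU : ∀ k, c / 4 * ‖ν k‖ ^ 2 ≤ U k := fun k => by
    have h1 : -(‖ν k‖ * R) ≤ inner ℝ (ν k) (r k) :=
      (neg_le_neg (mul_le_mul_of_nonneg_left (hr k) (norm_nonneg _))).trans
        (neg_le_of_abs_le (abs_real_inner_le_norm _ _))
    have h2 : 0 ≤ ρ k / 2 * ‖r k‖ ^ 2 := by have := hρpos k; positivity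
    have h3 : 0 ≤ c / 4 * (‖ν k‖ - 2 * R / c) ^ 2 := by positivity
    have h4 : c / 4 * (‖ν k‖ - 2 * R / c) ^ 2 = c / 4 * ‖ν k‖ ^ 2 - ‖ν k‖ * R + R ^ 2 / c := by
      field_simp
      ring
    have h5 := hlow k
    have h6 := hε₀ k
    simp only [U]
    linarith
  have hρs : Summable fun k => ρ (k + 1) - ρ k := by
    have := summable_sub_succ_of_antitone (u := fun k => -ρ k) (B := -ρhi) hρ.neg
      fun k => neg_le_neg (hρ_hi k)
    refine this.congr fun k => ?_
    ring
  let e : ℕ → ℝ := fun k => γ k * ε k + (R + 2 * R ^ 2 / c + ρhi / 2 * R ^ 2 + R ^ 2 / (2 * c))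
    * γ k ^ 2 + R ^ 2 / 2 * (ρ (k + 1) - ρ k) + E k
  have he : ∀ k, 0 ≤ e k := fun k => by
    have h1 := sub_nonneg.2 (hρ k.le_succ)
    have h2 := (hγ k).le
    have h3 := hε k
    have h4 := hE k
    simp only [e]
    simp only [Nat.succ_eq_add_one] at h1
    positivity
  have hes : Summable e := ((hγε.add (hγ_sq.mul_left _)).add (hρs.mul_left _)).add hEs
  have key : ∀ k, U (k + 1) ≤ (1 + 4 * R / c * γ k ^ 2) * U k - ρlo / 2 * (γ k * ‖r k‖ ^ 2)
      + e k := fun k => by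
    have hγk := (hγ k).le
    -- No bound on `ν k` is available, but the term is quadratic in `γ k` and linear in `‖ν k‖`; it
    -- becomes the factor `1 + α k` of the recursion.
    have h1 : γ k * inner ℝ (ν k) (r (k + 1) - r k) ≤ R * γ k ^ 2 + 4 * R / c * γ k ^ 2 * U k := by
      have ha : inner ℝ (ν k) (r (k + 1) - r k) ≤ ‖ν k‖ * (R * γ k) :=
        (real_inner_le_norm _ _).trans (mul_le_mul_of_nonneg_left (hΔ k) (norm_nonneg _))
      have hb : ‖ν k‖ ≤ 1 + ‖ν k‖ ^ 2 := by nlinarith [sq_nonneg (‖ν k‖ - 1)]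
      have hd : ‖ν k‖ ^ 2 ≤ 4 / c * U k := by
        calc ‖ν k‖ ^ 2 = 4 / c * (c / 4 * ‖ν k‖ ^ 2) := by field_simp
          _ ≤ _ := mul_le_mul_of_nonneg_left (hU k) (by positivity)
      calc γ k * inner ℝ (ν k) (r (k + 1) - r k) ≤ γ k * (‖ν k‖ * (R * γ k)) :=
            mul_le_mul_of_nonneg_left ha hγk
        _ = R * γ k ^ 2 * ‖ν k‖ := by ring
        _ ≤ R * γ k ^ 2 * (1 + 4 / c * U k) :=
            mul_le_mul_of_nonneg_left (by linarith) (by positivity)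
        _ = _ := by ring
    have h2 : -(γ k * D k) ≤ γ k * ε k := by
      rw [← mul_neg]
      exact mul_le_mul_of_nonneg_left (by linarith [hlow k]) hγk
    have hsq : ‖r (k + 1)‖ ^ 2 ≤ ‖r k‖ ^ 2 + 2 * R ^ 2 * γ k := by
      have ha : ‖r (k + 1)‖ - ‖r k‖ ≤ R * γ k := (norm_sub_norm_le _ _).trans (hΔ k)
      have hb : (‖r (k + 1)‖ - ‖r k‖) * (‖r (k + 1)‖ + ‖r k‖) ≤ R * γ k * (R + R) :=
        mul_le_mul ha (add_le_add (hr _) (hr _)) (by positivity) (by positivity)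
      linarith [hb]
    -- The dual update costs `γ / c * ‖r‖ ^ 2`; since `2 ≤ c * ρlo`, half of the penalty decrease
    -- pays for it.
    have h3 : γ k / c * ‖r (k + 1)‖ ^ 2
        ≤ ρlo / 2 * (γ k * ‖r k‖ ^ 2) + 2 * R ^ 2 / c * γ k ^ 2 := by
      have ha : γ k / c ≤ ρlo / 2 * γ k := by
        rw [div_le_iff₀ hc]
        nlinarith [mul_le_mul_of_nonneg_left hcρ hγk]
      calc γ k / c * ‖r (k + 1)‖ ^ 2 ≤ γ k / c * (‖r k‖ ^ 2 + 2 * R ^ 2 * γ k) := by gcongr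
        _ = γ k / c * ‖r k‖ ^ 2 + 2 * R ^ 2 / c * γ k ^ 2 := by ring
        _ ≤ ρlo / 2 * γ k * ‖r k‖ ^ 2 + 2 * R ^ 2 / c * γ k ^ 2 := by gcongr
        _ = _ := by ring
    have hr_sq : ‖r (k + 1)‖ ^ 2 ≤ R ^ 2 := by gcongr; exact hr _
    have h4 : (ρ (k + 1) - ρ k) / 2 * ‖r (k + 1)‖ ^ 2 ≤ R ^ 2 / 2 * (ρ (k + 1) - ρ k) := by
      have := mul_le_mul_of_nonneg_left hr_sq
        (div_nonneg (sub_nonneg.2 (hρ k.le_succ)) zero_le_two)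
      simp only [Nat.succ_eq_add_one] at this
      linarith
    have h5 : ρ k / 2 * ‖r (k + 1) - r k‖ ^ 2 ≤ ρhi / 2 * R ^ 2 * γ k ^ 2 := by
      calc ρ k / 2 * ‖r (k + 1) - r k‖ ^ 2 ≤ ρhi / 2 * (R * γ k) ^ 2 := by
            have := hρ_hi k
            have := hΔ k
            gcongr
        _ = _ := by ring
    have h6 : γ k ^ 2 / (2 * c) * ‖r (k + 1)‖ ^ 2 ≤ R ^ 2 / (2 * c) * γ k ^ 2 := by
      calc _ ≤ γ k ^ 2 / (2 * c) * R ^ 2 := by gcongr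
        _ = _ := by ring
    have h7 : γ k * ρ k * ‖r k‖ ^ 2 ≥ ρlo * (γ k * ‖r k‖ ^ 2) := by
      have := hρ_lo k
      calc ρlo * (γ k * ‖r k‖ ^ 2) ≤ ρ k * (γ k * ‖r k‖ ^ 2) := by gcongr
        _ = _ := by ring
    have hinner : inner ℝ (ν (k + 1)) (r (k + 1)) = inner ℝ (ν k) (r k)
        + inner ℝ (ν k) (r (k + 1) - r k) + γ k / c * ‖r (k + 1)‖ ^ 2 := by
      rw [hν, inner_add_left, real_inner_smul_left, real_inner_self_eq_norm_sq, inner_sub_right]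
      ring
    -- The weight `c / 2` matches the dual step `γ k / c`: the term `γ k * ⟪ν k, r k⟫` cancels its
    -- negative in `hD`.
    have hnorm : c / 2 * ‖ν (k + 1)‖ ^ 2 = c / 2 * ‖ν k‖ ^ 2 + γ k * inner ℝ (ν k) (r k)
        + γ k * inner ℝ (ν k) (r (k + 1) - r k) + γ k ^ 2 / (2 * c) * ‖r (k + 1)‖ ^ 2 := by
      rw [hν, norm_add_sq_real, inner_smul_right, norm_smul, mul_pow, Real.norm_eq_abs, sq_abs,
        inner_sub_right]
      field_simp
      ring
    have hr2 : ‖r (k + 1)‖ ^ 2 = ‖r k‖ ^ 2 + 2 * inner ℝ (r k) (r (k + 1) - r k)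
        + ‖r (k + 1) - r k‖ ^ 2 := by
      rw [← norm_add_sq_real, add_sub_cancel]
    have hρr : ρ (k + 1) / 2 * ‖r (k + 1)‖ ^ 2 = (ρ (k + 1) - ρ k) / 2 * ‖r (k + 1)‖ ^ 2
        + (ρ k / 2 * ‖r k‖ ^ 2 + ρ k * inner ℝ (r k) (r (k + 1) - r k)
        + ρ k / 2 * ‖r (k + 1) - r k‖ ^ 2) := by
      linear_combination (ρ k / 2) * hr2
    have hDk := hD k
    have hUk : U (k + 1) = D (k + 1) + inner ℝ (ν (k + 1)) (r (k + 1))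
        + ρ (k + 1) / 2 * ‖r (k + 1)‖ ^ 2 + c / 2 * ‖ν (k + 1)‖ ^ 2 + (ε₀ + R ^ 2 / c) := rfl
    have hUk' : U k = D k + inner ℝ (ν k) (r k) + ρ k / 2 * ‖r k‖ ^ 2
      + c / 2 * ‖ν k‖ ^ 2 + (ε₀ + R ^ 2 / c) := rfl
    have hek : e k = γ k * ε k + (R + 2 * R ^ 2 / c + ρhi / 2 * R ^ 2 + R ^ 2 / (2 * c))
      * γ k ^ 2 + R ^ 2 / 2 * (ρ (k + 1) - ρ k) + E k := rfl
    rw [hinner, hnorm, hρr] at hUk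
    rw [add_mul, one_mul, hek]
    linarith
  have hs := summable_of_le_one_add_mul_sub_add (fun k => le_trans (by positivity) (hU k))
    (fun k => by positivity) (fun k => by have := (hγ k).le; positivity) he
    (hγ_sq.mul_left (4 * R / c)) hes key
  exact (summable_mul_left_iff (by positivity)).1 hs

/-- Otherwise `γ` would grow geometrically, although it is at most `1`. Hence the assumption on `γhi
/ c` yields `2 ≤ c * ρlo`. -/
theorem ParameterAssumptions.one_le_γhi {ζ : ℝ → ℝ} {γ β θ ρ : ℕ → ℝ} {γlo γhi ρlo ρhi c : ℝ}
    (hpar : ParameterAssumptions ζ γ β θ ρ γlo γhi ρlo ρhi c) : 1 ≤ γhi := by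
  by_contra! hlt
  have h : ∀ k, γ 0 ≤ γhi ^ k * γ k := fun k => by
    induction k with
    | zero => simp
    | succ k ih =>
      have h1 := (div_le_iff₀ (hpar.γ_mem (k + 1)).1).1 (hpar.γ_ratio k).2
      calc γ 0 ≤ γhi ^ k * γ k := ih
        _ ≤ γhi ^ k * (γhi * γ (k + 1)) :=
            mul_le_mul_of_nonneg_left h1 (pow_nonneg hpar.γhi_pos.le k)
        _ = _ := by ring
  refine (hpar.γ_mem 0).1.not_ge (ge_of_tendsto
    (tendsto_pow_atTop_nhds_zero_of_lt_one hpar.γhi_pos.le hlt) (Eventually.of_forall fun k => ?_))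
  exact (h k).trans (mul_le_of_le_one_right (pow_nonneg hpar.γhi_pos.le k) (hpar.γ_mem k).2)

/-! ### Finite values and saddle points -/

section
variable {Hp Hd Hv : Type*}
  [NormedAddCommGroup Hp] [InnerProductSpace ℝ Hp]
  [NormedAddCommGroup Hd] [InnerProductSpace ℝ Hd]
  [NormedAddCommGroup Hv] [InnerProductSpace ℝ Hv]
  {f : Hp → EReal} {g : Hv → EReal} {h : Hp → EReal} {T : Hp →L[ℝ] Hv} {A : Hp →L[ℝ] Hd} {b : Hd}
  {F : Hp → EReal} {ζ : ℝ → ℝ}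

theorem ProblemAssumptions.mem_dom_f (hprob : ProblemAssumptions f g h T A b F ζ) {x : Hp}
    (hx : x ∈ dom h) : x ∈ dom f :=
  hprob.smooth.2.2.1 hx

theorem ProblemAssumptions.mem_dom_g (hprob : ProblemAssumptions f g h T A b F ζ) {x : Hp}
    (hx : x ∈ dom h) : T x ∈ dom g :=
  hprob.g_gamma0.mem_dom_of_mem_subdiff (hprob.subdiff_nonempty ⟨x, hx, rfl⟩).some_mem

theorem ProblemAssumptions.hasGradAt_f (hprob : ProblemAssumptions f g h T A b F ζ) {x : Hp}
    (hx : x ∈ dom h) : HasGradAt f (grad f x) x := by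
  obtain ⟨-, -, -, C₀, -, hCC, -, hdiff, -⟩ := hprob.smooth
  obtain ⟨w, hw⟩ := (hdiff x (hCC hx)).2
  rwa [hw.grad_eq]

theorem ProblemAssumptions.lagrangian_eq (hprob : ProblemAssumptions f g h T A b F ζ) {x : Hp}
    (hx : x ∈ dom h) (μ : Hd) : lagrangian f g h T A b x μ
      = (((f x).toReal + (g (T x)).toReal + (h x).toReal + inner ℝ μ (A x - b) : ℝ) : EReal) := by
  rw [lagrangian, ← hprob.f_gamma0.coe_toReal (hprob.mem_dom_f hx),
    ← hprob.g_gamma0.coe_toReal (hprob.mem_dom_g hx), ← hprob.h_gamma0.coe_toReal hx]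
  norm_cast

theorem ProblemAssumptions.mem_dom_of_isSaddlePoint
    (hprob : ProblemAssumptions f g h T A b F ζ) {xs : Hp} {μs : Hd}
    (hs : IsSaddlePoint (lagrangian f g h T A b) xs μs) : xs ∈ dom h := by
  obtain ⟨x₀, hx₀⟩ := hprob.h_gamma0.proper
  have h1 := (hs x₀ μs).2
  rw [hprob.lagrangian_eq hx₀] at h1
  refine (lt_top_iff_ne_top (α := EReal)).2 fun hx => ?_
  rw [lagrangian, hx, EReal.add_top_of_ne_bot, EReal.top_add_coe] at h1
  · exact EReal.coe_ne_top _ (top_le_iff.1 h1)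
  · simp [EReal.add_eq_bot_iff, hprob.f_gamma0.ne_bot, hprob.g_gamma0.ne_bot]

theorem ProblemAssumptions.feasible_of_isSaddlePoint
    (hprob : ProblemAssumptions f g h T A b F ζ) {xs : Hp} {μs : Hd}
    (hs : IsSaddlePoint (lagrangian f g h T A b) xs μs) : A xs = b := by
  have hxs := hprob.mem_dom_of_isSaddlePoint hs
  -- Moving the multiplier along the residual would raise the Lagrangian by `‖A xs - b‖ ^ 2`.
  have h1 := (hs xs (μs + (A xs - b))).1
  rw [hprob.lagrangian_eq hxs, hprob.lagrangian_eq hxs, EReal.coe_le_coe_iff, inner_add_left,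
    real_inner_self_eq_norm_sq] at h1
  have h2 : ‖A xs - b‖ ^ 2 ≤ 0 := by linarith
  rw [← sub_eq_zero, ← norm_eq_zero]
  exact pow_eq_zero_iff two_ne_zero |>.1 (le_antisymm h2 (sq_nonneg _))

theorem ProblemAssumptions.toReal_le_of_isSaddlePoint
    (hprob : ProblemAssumptions f g h T A b F ζ) {xs x : Hp} {μs : Hd}
    (hs : IsSaddlePoint (lagrangian f g h T A b) xs μs) (hx : x ∈ dom h) :
    (f xs).toReal + (g (T xs)).toReal + (h xs).toReal
      ≤ (f x).toReal + (g (T x)).toReal + (h x).toReal + inner ℝ μs (A x - b) := by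
  have h1 := (hs x μs).2
  rw [hprob.lagrangian_eq (hprob.mem_dom_of_isSaddlePoint hs), hprob.lagrangian_eq hx,
    EReal.coe_le_coe_iff, hprob.feasible_of_isSaddlePoint hs, sub_self, inner_zero_right,
    add_zero] at h1
  exact h1

/-! ### The CGALP iteration -/

variable [CompleteSpace Hp] [CompleteSpace Hd] [CompleteSpace Hv]
  {γ β θ ρ : ℕ → ℝ} {x : ℕ → Hp} {y : ℕ → Hv} {z s : ℕ → Hp} {μ : ℕ → Hd}

theorem IsCGALP.s_mem (halg : IsCGALP f g h T A b γ β θ ρ x y z s μ) (hh : Gamma0 h) (k : ℕ) :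
    s k ∈ dom h := by
  have h1 := halg.s_step k (Set.mem_univ (x 0))
  simp only [Set.mem_ofPred_eq] at h1
  refine (lt_top_iff_ne_top (α := EReal)).2 fun hx => ?_
  rw [hx, EReal.top_add_coe, ← hh.coe_toReal halg.x_zero] at h1
  exact absurd (top_le_iff.1 h1) (by exact_mod_cast EReal.coe_ne_top _)

theorem IsCGALP.s_le (halg : IsCGALP f g h T A b γ β θ ρ x y z s μ) (hh : Gamma0 h) (k : ℕ)
    {u : Hp} (hu : u ∈ dom h) :
    (h (s k)).toReal + inner ℝ (z k) (s k) ≤ (h u).toReal + inner ℝ (z k) u := by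
  have h1 := halg.s_step k (Set.mem_univ u)
  simp only [Set.mem_ofPred_eq] at h1
  rw [← hh.coe_toReal hu, ← hh.coe_toReal (halg.s_mem hh k)] at h1
  exact_mod_cast h1

theorem IsCGALP.x_succ (halg : IsCGALP f g h T A b γ β θ ρ x y z s μ) (k : ℕ) :
    x (k + 1) = x k + γ k • (s k - x k) := by
  rw [halg.x_step]
  module

theorem IsCGALP.x_mem (halg : IsCGALP f g h T A b γ β θ ρ x y z s μ) (hh : Gamma0 h)
    (hγ : ∀ k, γ k ∈ Set.Ioc (0 : ℝ) 1) (k : ℕ) : x k ∈ dom h := by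
  induction k with
  | zero => exact halg.x_zero
  | succ k ih =>
    rw [halg.x_succ]
    exact hh.convexOn_toReal.1.add_smul_sub_mem ih (halg.s_mem hh k) ⟨(hγ k).1.le, (hγ k).2⟩

/-- One step of the conditional gradient iteration, compared with a feasible point `u` of
`dom h`. -/
theorem IsCGALP.step (halg : IsCGALP f g h T A b γ β θ ρ x y z s μ)
    (hprob : ProblemAssumptions f g h T A b F ζ) (hγ : ∀ k, γ k ∈ Set.Ioc (0 : ℝ) 1)
    (hβ : ∀ k, 0 < β k) (hβ_anti : Antitone β) {u : Hp} (hu : u ∈ dom h) (hAu : A u = b)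
    {M : ℝ} (hM : ∀ x ∈ dom h, ∃ v, IsMinNormSubgradient g (T x) v ∧ ‖v‖ ≤ M) {R : ℝ}
    (hR : ∀ x ∈ dom h, ‖x‖ ≤ R) (k : ℕ) :
    (f (x (k + 1))).toReal + moreauValue (β (k + 1)) g (T (x (k + 1))) (y (k + 1))
        + (h (x (k + 1))).toReal
      ≤ (1 - γ k) * ((f (x k)).toReal + moreauValue (β k) g (T (x k)) (y k) + (h (x k)).toReal)
        + γ k * ((f u).toReal + (g (T u)).toReal + (h u).toReal)
        - γ k * inner ℝ (μ k + ρ k • (A (x k) - b)) (A (x k) - b)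
        - inner ℝ (μ k + ρ k • (A (x k) - b)) (A (x (k + 1)) - A (x k))
        + ((curvature F ζ (dom h)).toReal * ζ (γ k)
          + (‖T‖ * (2 * R)) ^ 2 / 2 * (γ k ^ 2 / β k) + M ^ 2 / 2 * (β k - β (k + 1))) := by
  have hh := hprob.h_gamma0
  have hx := halg.x_mem hh hγ k
  have hx' := halg.x_mem hh hγ (k + 1)
  have hs := halg.s_mem hh k
  have hγk := (hγ k).1
  have hβk := hβ k
  have h1 := hprob.smooth.descent hh.convexOn_toReal.1 hx hs (hγ k)
  rw [← halg.x_succ] at h1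
  obtain ⟨v, ⟨hv, -⟩, hvM⟩ := hM _ hx'
  have h2 := (halg.y_step k).moreauValue_step hprob.g_gamma0 hβk (hβ (k + 1))
    (hβ_anti k.le_succ) (halg.y_step (k + 1)) hv
  have h3 : (h (x (k + 1))).toReal ≤ (1 - γ k) * (h (x k)).toReal + γ k * (h (s k)).toReal := by
    have := hh.convexOn_toReal.2 hx hs (sub_nonneg.2 (hγ k).2) hγk.le (sub_add_cancel 1 (γ k))
    rwa [show (1 - γ k) • x k + γ k • s k = x (k + 1) by rw [halg.x_succ]; module] at this
  have h4 := halg.s_le hh k hu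
  have h5 := hprob.f_gamma0.add_inner_le (hprob.mem_dom_f hx) (hprob.mem_dom_f hu)
    (hprob.hasGradAt_f hx)
  have h6 := (halg.y_step k).moreauValue_add_inner_le hprob.g_gamma0 hβk (hprob.mem_dom_g hu)
  have hz : ∀ d, inner ℝ (z k) d = inner ℝ (grad f (x k)) d
      + inner ℝ ((1 / β k) • (T (x k) - y k)) (T d)
      + inner ℝ (μ k + ρ k • (A (x k) - b)) (A d) := fun d => by
    rw [halg.z_step]
    simp only [inner_add_left, real_inner_smul_left, ContinuousLinearMap.adjoint_inner_left]
    ring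
  have hTx : T (x (k + 1)) - T (x k) = γ k • T (s k - x k) := by
    rw [← map_sub, halg.x_succ, add_sub_cancel_left, map_smul]
  have hAx : A (x (k + 1)) - A (x k) = γ k • A (s k - x k) := by
    rw [← map_sub, halg.x_succ, add_sub_cancel_left, map_smul]
  have hAu' : A (u - x k) = -(A (x k) - b) := by rw [map_sub, hAu, neg_sub]
  have hTn : ‖T (s k - x k)‖ ≤ ‖T‖ * (2 * R) := by
    refine (T.le_opNorm _).trans (mul_le_mul_of_nonneg_left ?_ (norm_nonneg _))
    linarith [norm_sub_le (s k) (x k), hR _ hx, hR _ hs]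
  have h7 : 1 / (2 * β k) * ‖T (x (k + 1)) - T (x k)‖ ^ 2
      ≤ (‖T‖ * (2 * R)) ^ 2 / 2 * (γ k ^ 2 / β k) := by
    rw [hTx, norm_smul, mul_pow, Real.norm_eq_abs, sq_abs]
    calc 1 / (2 * β k) * (γ k ^ 2 * ‖T (s k - x k)‖ ^ 2)
        = ‖T (s k - x k)‖ ^ 2 / 2 * (γ k ^ 2 / β k) := by field_simp
      _ ≤ _ := by gcongr
  have h8 : (β k - β (k + 1)) / 2 * ‖v‖ ^ 2 ≤ M ^ 2 / 2 * (β k - β (k + 1)) := by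
    have ha : 0 ≤ β k - β (k + 1) := sub_nonneg.2 (hβ_anti k.le_succ)
    calc (β k - β (k + 1)) / 2 * ‖v‖ ^ 2 ≤ (β k - β (k + 1)) / 2 * M ^ 2 := by gcongr
      _ = _ := by ring
  rw [hTx, inner_smul_right, ← hTx] at h2
  rw [← map_sub] at h6
  have hzs := hz (s k - x k)
  have hzu := hz (u - x k)
  rw [hAu', inner_neg_right] at hzu
  rw [inner_sub_right] at hzs hzu
  rw [hAx, inner_smul_right]
  -- Optimality of `s k` against `u` bounds the linearized objective; the linearizations of `f` and
  -- of the envelope at `u` are then bounded by convexity, and `A u = b` turns the remaining part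
  -- into the residual.
  have h9 : inner ℝ (grad f (x k)) (s k - x k)
      + inner ℝ ((1 / β k) • (T (x k) - y k)) (T (s k - x k)) + (h (s k)).toReal
      ≤ (f u).toReal + (g (T u)).toReal + (h u).toReal - (f (x k)).toReal
        - moreauValue (β k) g (T (x k)) (y k) - inner ℝ (μ k + ρ k • (A (x k) - b)) (A (x k) - b)
        - inner ℝ (μ k + ρ k • (A (x k) - b)) (A (s k - x k)) := by
    linarith
  have h10 := mul_le_mul_of_nonneg_left h9 hγk.le
  linarith

theorem IsCGALP.summable_mul_norm_sq {γlo γhi ρlo ρhi c : ℝ}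
    (halg : IsCGALP f g h T A b γ β θ ρ x y z s μ)
    (hprob : ProblemAssumptions f g h T A b F ζ)
    (hpar : ParameterAssumptions ζ γ β θ ρ γlo γhi ρlo ρhi c) :
    (∃ L, ∀ k, |‖A (x (k + 1)) - b‖ ^ 2 - ‖A (x k) - b‖ ^ 2| ≤ L * γ k) ∧
      (Summable fun k => γ k ^ 2) ∧ Summable fun k => γ k * ‖A (x k) - b‖ ^ 2 := by
  have hh := hprob.h_gamma0
  have hx := halg.x_mem hh hpar.γ_mem
  have hγ := fun k => (hpar.γ_mem k).1
  obtain ⟨R, hR⟩ := hprob.compact.exists_norm_le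
  obtain ⟨M, hM⟩ := hprob.subdiff_bounded
  obtain ⟨xs, μs, hsad⟩ := hprob.saddle
  have hxs := hprob.mem_dom_of_isSaddlePoint hsad
  have hAxs := hprob.feasible_of_isSaddlePoint hsad
  have hR0 : 0 ≤ R := (norm_nonneg _).trans (hR xs hxs)
  set Q := ‖A‖ * (2 * R) with hQ
  have hQ0 : 0 ≤ Q := by positivity
  have hA : ∀ u ∈ dom h, ∀ v ∈ dom h, ‖A (u - v)‖ ≤ Q := fun u hu v hv =>
    (A.le_opNorm _).trans (mul_le_mul_of_nonneg_left
      (by linarith [norm_sub_le u v, hR u hu, hR v hv]) (norm_nonneg _))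
  have hr : ∀ k, ‖A (x k) - b‖ ≤ Q := fun k => by
    rw [← hAxs, ← map_sub]
    exact hA _ (hx k) _ hxs
  have hΔ : ∀ k, ‖A (x (k + 1)) - b - (A (x k) - b)‖ ≤ Q * γ k := fun k => by
    rw [sub_sub_sub_cancel_right, ← map_sub, halg.x_succ, add_sub_cancel_left, map_smul,
      norm_smul, Real.norm_of_nonneg (hγ k).le, mul_comm]
    exact mul_le_mul_of_nonneg_right (hA _ (halg.s_mem hh k) _ (hx k)) (hγ k).le
  have hsq : Summable fun k => γ k ^ 2 := by
    refine Summable.of_nonneg_of_le (fun k => sq_nonneg _) (fun k => ?_)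
      (hpar.summable_sq_div.mul_left (β 0))
    have hβk := hpar.β_pos k
    calc γ k ^ 2 = β k * (γ k ^ 2 / β k) := by field_simp
      _ ≤ _ := mul_le_mul_of_nonneg_right (hpar.β_antitone k.zero_le) (by positivity)
  refine ⟨⟨2 * Q ^ 2, fun k => ?_⟩, hsq, ?_⟩
  · have h1 := (abs_norm_sub_norm_le _ _).trans (hΔ k)
    rw [sq_sub_sq, abs_mul, abs_of_nonneg (add_nonneg (norm_nonneg _) (norm_nonneg _))]
    calc _ ≤ (Q + Q) * (Q * γ k) :=
          mul_le_mul (add_le_add (hr _) (hr _)) h1 (abs_nonneg _) (by positivity)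
      _ = _ := by ring
  set p := (f xs).toReal + (g (T xs)).toReal + (h xs).toReal with hp
  have hρ_lo : ∀ k, ρlo ≤ ρ k := fun k => hpar.ρ_inf.1 ⟨k, rfl⟩
  refine summable_mul_norm_residual_sq
    -- Including `μs` in `D` lets the saddle inequality bound it below; only `μ k - μs` is left for
    -- the Lyapunov function.
    (D := fun k => (f (x k)).toReal + moreauValue (β k) g (T (x k)) (y k) + (h (x k)).toReal
      - p + inner ℝ μs (A (x k) - b))
    (E := fun k => (curvature F ζ (dom h)).toReal * ζ (γ k)
      + (‖T‖ * (2 * R)) ^ 2 / 2 * (γ k ^ 2 / β k) + M ^ 2 / 2 * (β k - β (k + 1)))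
    (ε := fun k => M ^ 2 / 2 * β k) (ε₀ := M ^ 2 / 2 * β 0) (ν := fun k => μ k - μs)
    (r := fun k => A (x k) - b) hpar.c_pos ?_ hpar.ρlo_pos hpar.ρ_monotone hρ_lo
    (fun k => hpar.ρ_sup.1 ⟨k, rfl⟩) hγ hsq (fun k => ?_) (fun k => ?_) ?_ (fun k => ?_) ?_
    hr hΔ (fun k => ?_) (fun k => ?_) fun k => ?_
  · have h1 : γhi / c < ρlo / 2 := by linarith [hpar.c_large]
    rw [div_lt_iff₀ hpar.c_pos] at h1
    linarith [hpar.one_le_γhi]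
  · have := hpar.β_pos k
    positivity
  · have := hpar.β_antitone k.zero_le
    gcongr
  · refine (hpar.summable_mul.mul_left (M ^ 2 / 2)).congr fun k => ?_
    ring
  · have h1 := hpar.β_pos k
    have h2 := hprob.smooth.2.1 _ (hpar.γ_mem k)
    have h3 : 0 ≤ β k - β (k + 1) := sub_nonneg.2 (hpar.β_antitone k.le_succ)
    positivity
  · exact ((hpar.summable_ζ.mul_left _).add (hpar.summable_sq_div.mul_left _)).add
      ((summable_sub_succ_of_antitone hpar.β_antitone fun k => (hpar.β_pos k).le).mul_left _)
  · rw [halg.μ_step, hpar.θ_eq]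
    abel
  · obtain ⟨v, ⟨hv, -⟩, hvM⟩ := hM _ (hx k)
    have h1 := (halg.y_step k).le_moreauValue hprob.g_gamma0 (hpar.β_pos k) hv
    have h2 := hprob.toReal_le_of_isSaddlePoint hsad (hx k)
    have h3 : β k / 2 * ‖v‖ ^ 2 ≤ M ^ 2 / 2 * β k := by
      have := hpar.β_pos k
      calc β k / 2 * ‖v‖ ^ 2 ≤ β k / 2 * M ^ 2 := by gcongr
        _ = _ := by ring
    linarith
  · have h1 := halg.step hprob hpar.γ_mem hpar.β_pos hpar.β_antitone hxs hAxs hM hR k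
    rw [← hp] at h1
    simp only [inner_add_left, inner_sub_left, inner_sub_right, real_inner_smul_left,
      ← real_inner_self_eq_norm_sq] at h1 ⊢
    linarith

end
end CGALP

theorem theorem4p1
    {Hp Hd Hv : Type*}
    [NormedAddCommGroup Hp] [InnerProductSpace ℝ Hp] [CompleteSpace Hp]
    [NormedAddCommGroup Hd] [InnerProductSpace ℝ Hd] [CompleteSpace Hd]
    [NormedAddCommGroup Hv] [InnerProductSpace ℝ Hv] [CompleteSpace Hv]
    (f : Hp → EReal) (g : Hv → EReal) (h : Hp → EReal)
    (T : Hp →L[ℝ] Hv) (A : Hp →L[ℝ] Hd) (b : Hd) (F : Hp → EReal) (ζ : ℝ → ℝ)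
    (hprob : CGALP.ProblemAssumptions f g h T A b F ζ)
    (γ β θ ρ : ℕ → ℝ) (γlo γhi ρlo ρhi c : ℝ)
    (hpar : CGALP.ParameterAssumptions ζ γ β θ ρ γlo γhi ρlo ρhi c)
    (x : ℕ → Hp) (y : ℕ → Hv) (z s : ℕ → Hp) (μ : ℕ → Hd)
    (halg : CGALP.IsCGALP f g h T A b γ β θ ρ x y z s μ) :
    Tendsto (fun k => A (x k)) atTop (𝓝 b) ∧
    ((fun k => (Finset.range (k + 1)).inf' Finset.nonempty_range_add_one
        (fun i => ‖A (x i) - b‖))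
      =O[atTop] (fun k => 1 / √(CGALP.cumStep γ k))) ∧
    (∃ φ : ℕ → ℕ, StrictMono φ ∧
      ∀ j, ‖A (x (φ j)) - b‖ ≤ 1 / √(CGALP.cumStep γ (φ j))) ∧
    ((fun k => ‖A (CGALP.ergodicAverage γ x k) - b‖)
      =O[atTop] (fun k => 1 / √(CGALP.cumStep γ k))) := by
  have hγ := fun k => (hpar.γ_mem k).1
  obtain ⟨⟨L, hL⟩, hsq, hs⟩ := halg.summable_mul_norm_sq hprob hpar
  have hns := hpar.not_summable
  refine ⟨?_, CGALP.isBigO_inf'_inv_sqrt_cumStep hγ (fun k => norm_nonneg _) hs,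
    CGALP.exists_strictMono_le_inv_sqrt_cumStep hγ hns hs, CGALP.isBigO_ergodicAverage A b hγ hs⟩
  -- Applied to the squared residual, since it is the square that is summable against `γ`.
  have h1 := CGALP.tendsto_zero_of_summable_mul (fun k => (hγ k).le)
    (fun k => sq_nonneg ‖A (x k) - b‖) hns hsq hs hL
  rw [tendsto_iff_norm_sub_tendsto_zero]
  have h2 := (Real.continuous_sqrt.tendsto 0).comp h1
  rw [Real.sqrt_zero] at h2
  exact h2.congr fun k => Real.sqrt_sq (norm_nonneg _)
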